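/- Let $N$ be prime, $1\le S\le L<N$ and $K\ge 0$ integers, and let $\mathbf F$ be the unitary $N$-point DFT matrix, $F_{n,m}=N^{-1/2}e^{-2\pi i nm/N}$ for $0\le n,m<N$. Consider $K$ fading blocks. In block $k$ the channel support $\mathcal L^{(k)}$ is a random $S$-element subset of $\{0,\dots,L-1\}$, drawn from an arbitrary prior distribution on these subsets (the same for every block). The vector $\mathbf h_{\mathrm{nz}}^{(k)}\in\mathbb C^S$ of the taps $h^{(k)}[l]$, $l\in\mathcal L^{(k)}$, listed in increasing order of $l$, is circular complex Gaussian $\mathcal{CN}(\mathbf 0,\mathbf Q)$ with a fixed positive definite covariance matrix $\mathbf Q$ (for instance $\mathbf Q=S^{-1}\mathbf I$); the other taps are zero. The noise $\mathbf v^{(k)}\in\mathbb C^N$ is $\mathcal{CN}(\mathbf 0,\mathbf I)$. Support, non-zero taps and noise are independent of one another, and different blocks are independent. With a cyclic prefix, the received samples at signal-to-noise ratio $\rho>0$ are $$y^{(k)}[n]=\sqrt\rho\sum_{l=0}^{L-1}h^{(k)}[l]\,x^{(k)}[(n-l)\bmod N]+v^{(k)}[n],\qquad 0\le n<N.$$ Let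 $\mathcal N_{\mathrm p}\subset\{0,\dots,N-1\}$ be any set of $P\ge S+1$ pilot subcarriers. The transmitted vector is $\mathbf x^{(k)}=\mathbf F^{\mathsf H}\mathbf x_{\mathrm f}^{(k)}$, where $x_{\mathrm f}^{(k)}[n]$ is a fixed pilot symbol $x_{\mathrm p}[n]$ with $|x_{\mathrm p}[n]|=1$ (known to the receiver, the same in every block and for every $\rho$) for $n\in\mathcal N_{\mathrm p}$, and an arbitrary, possibly random and $\rho$-dependent, data symbol for $n\notin\mathcal N_{\mathrm p}$. Let $\mathbf y_{\mathrm p}^{(k)}$ be the entries of $\mathbf F\mathbf y^{(k)}$ in $\mathcal N_{\mathrm p}$, and put $\mathbf z_{\mathrm p}^{(k)}=(\rho N)^{-1/2}\,\mathrm{Diag}(\mathbf x_{\mathrm p}^*)\,\mathbf y_{\mathrm p}^{(k)}$. For an $S$-element set $A\subset\{0,\dots,L-1\}$ let $\mathbf F_A\in\mathbb C^{P\times S}$ be formed from the rows $\mathcal N_{\mathrm p}$ and the columns $A$ of $\mathbf F$, and let $\mathbf\Pi_A=\mathbf F_A(\mathbf F_A^{\mathsf H}\mathbf F_A)^{-1}\mathbf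 F_A^{\mathsf H}$. The pilot-aided support estimator (PASE) decides, in each block, for a set $$\widehat{\mathcal L}^{(k)}\in\arg\min_{A}\ \bigl\|(\mathbf I-\mathbf\Pi_A)\,\mathbf z_{\mathrm p}^{(k)}\bigr\|^2,$$ with ties broken in any way. Then the probability of a support-detection error vanishes at high SNR: $$\lim_{\rho\to\infty}\Pr\bigl\{\widehat{\mathcal L}^{(k)}\ne\mathcal L^{(k)}\text{ for some }k\in\{1,\dots,K\}\bigr\}=0.$$ In particular, the error probability in each single block tends to $0$. -/

import Mathlib

open MeasureTheory ProbabilityTheory Filter Topology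
open scoped Matrix ComplexOrder

noncomputable section

namespace SparseChannel

/-- The unitary `N`-point DFT matrix, `F[n,m] = N^{-1/2} exp(-2πi n m / N)`. -/
def dftMatrix (N : ℕ) : Matrix (Fin N) (Fin N) ℂ :=
  fun n m => ((Real.sqrt N : ℝ) : ℂ)⁻¹ *
    Complex.exp (-(2 * Real.pi * Complex.I * ((n : ℕ) : ℂ) * ((m : ℕ) : ℂ)) / (N : ℂ))

/-- The circular complex Gaussian law `CN(m, Q)` on `ℂ^ι`, given by its density
`(π^|ι| det Q)⁻¹ exp(-(x-m)ᴴ Q⁻¹ (x-m))` with respect to Lebesgue measure (`Q` positive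
definite, so that the determinant and the quadratic form are real). -/
def complexGaussian {ι : Type*} [Fintype ι] [DecidableEq ι] (m : ι → ℂ) (Q : Matrix ι ι ℂ) :
    Measure (ι → ℂ) :=
  (volume : Measure (ι → ℂ)).withDensity fun x =>
    ENNReal.ofReal ((Real.pi ^ Fintype.card ι * Q.det.re)⁻¹ *
      Real.exp (-(star (x - m) ⬝ᵥ (Q⁻¹ *ᵥ (x - m))).re))

/-- The channel-support hypotheses: the `S`-element subsets of the tap positions
`{0, …, L-1}`. -/
def Support (L S : ℕ) : Type := {A : Finset (Fin L) // A.card = S}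

instance (L S : ℕ) : DecidableEq (Support L S) :=
  inferInstanceAs (DecidableEq {A : Finset (Fin L) // A.card = S})

instance (L S : ℕ) : Fintype (Support L S) :=
  inferInstanceAs (Fintype {A : Finset (Fin L) // A.card = S})

instance (L S : ℕ) : MeasurableSpace (Support L S) := ⊤

/-- The impulse response with support `A` and vector `g` of non-zero taps (listed in increasing
order of the tap position); all the other taps vanish. -/
def impulseResponse {L S : ℕ} (A : Support L S) (g : Fin S → ℂ) (l : Fin L) : ℂ :=
  if hl : l ∈ A.1 then g ((A.1.orderIsoOfFin A.2).symm ⟨l, hl⟩) else 0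

/-- The transmission over one fading block, with a cyclic prefix: the sample `x[n - l]` with
`n < l` is `x[N + n - l]`, so that
`y[n] = √ρ ∑ l, h[l] x[(n - l) mod N] + v[n]` for `0 ≤ n < N`. -/
def received {N L : ℕ} (ρ : ℝ) (h : Fin L → ℂ) (x v : Fin N → ℂ) (n : Fin N) : ℂ :=
  ((Real.sqrt ρ : ℝ) : ℂ) *
      ∑ l : Fin L, h l * x ⟨((n : ℕ) + N - (l : ℕ)) % N, Nat.mod_lt _ n.pos⟩ + v n

/-- The frequency-domain transmission vector of pilot-aided transmission: pilot symbols on the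
subcarriers in `Np`, data symbols on the others. -/
def patVector {N : ℕ} (Np : Finset (Fin N)) (pilot : {n // n ∈ Np} → ℂ)
    (data : {n // n ∉ Np} → ℂ) (n : Fin N) : ℂ :=
  if hn : n ∈ Np then pilot ⟨n, hn⟩ else data ⟨n, hn⟩

/-- The frequency-domain pilot observations `y_p`: the entries in `Np` of `F y`, where `y` is
received when the time-domain vector `Fᴴ x_f` is sent, `x_f` being the vector of pilots and
data. -/
def pilotObservation {N L : ℕ} (ρ : ℝ) (Np : Finset (Fin N)) (pilot : {n // n ∈ Np} → ℂ)
    (data : {n // n ∉ Np} → ℂ) (h : Fin L → ℂ) (v : Fin N → ℂ) (n : {n // n ∈ Np}) : ℂ :=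
  (dftMatrix N *ᵥ received ρ h ((dftMatrix N)ᴴ *ᵥ patVector Np pilot data) v) n

/-- The normalized pilot observations `z_p = (ρN)^{-1/2} Diag(x_p^*) y_p`. -/
def normalizedObservation {N : ℕ} (ρ : ℝ) (Np : Finset (Fin N)) (pilot y : {n // n ∈ Np} → ℂ)
    (n : {n // n ∈ Np}) : ℂ :=
  ((Real.sqrt (ρ * N) : ℝ) : ℂ)⁻¹ * (star (pilot n) * y n)

/-- The rows `Np` and the columns `A` of the DFT matrix. Column positions lie in
`{0, …, L-1}`, a subset of `{0, …, N-1}`. -/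
def pilotDFT {N L S : ℕ} (hLN : L ≤ N) (Np : Finset (Fin N)) (A : Support L S) :
    Matrix {n // n ∈ Np} {l // l ∈ A.1} ℂ :=
  fun n l => dftMatrix N n.1 (Fin.castLE hLN l.1)

/-- The projection `Π = F_A (F_Aᴴ F_A)⁻¹ F_Aᴴ` onto the column space of `pilotDFT`. -/
def pilotProjection {N L S : ℕ} (hLN : L ≤ N) (Np : Finset (Fin N)) (A : Support L S) :
    Matrix {n // n ∈ Np} {n // n ∈ Np} ℂ :=
  pilotDFT hLN Np A * ((pilotDFT hLN Np A)ᴴ * pilotDFT hLN Np A)⁻¹ * (pilotDFT hLN Np A)ᴴ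

/-- The energy `‖(I - Π) z‖²` of the projection error of `z` under the hypothesis `A`. -/
def residualEnergy {N L S : ℕ} (hLN : L ≤ N) (Np : Finset (Fin N)) (z : {n // n ∈ Np} → ℂ)
    (A : Support L S) : ℝ :=
  ∑ n, ‖((1 - pilotProjection hLN Np A) *ᵥ z) n‖ ^ 2

/-- `A` is a decision of the pilot-aided support estimator from the pilot observations `y`: it
minimizes the energy of the projection error of the normalized observations over all support
hypotheses. -/
def IsPASE {N L S : ℕ} (hLN : L ≤ N) (ρ : ℝ) (Np : Finset (Fin N))
    (pilot y : {n // n ∈ Np} → ℂ) (A : Support L S) : Prop :=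
  ∀ B : Support L S,
    residualEnergy hLN Np (normalizedObservation ρ Np pilot y) A ≤
      residualEnergy hLN Np (normalizedObservation ρ Np pilot y) B

/-- The statistics of the `S`-sparse frequency-selective block-fading channel over `K` blocks of
length `N`: in each block the support is drawn from the prior `prior`, the vector of non-zero
taps is `CN(0, Q)`, the time-domain noise is `CN(0, I)`, these three are independent, and
different blocks are independent. -/
structure IsSparseFading {Ω : Type*} [MeasurableSpace Ω] (P : Measure Ω) {N L S K : ℕ}
    (prior : PMF (Support L S)) (Q : Matrix (Fin S) (Fin S) ℂ)
    (supp : Fin K → Ω → Support L S) (taps : Fin K → Ω → Fin S → ℂ)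
    (noise : Fin K → Ω → Fin N → ℂ) : Prop where
  supp_law : ∀ k, HasLaw (supp k) prior.toMeasure P
  taps_law : ∀ k, HasLaw (taps k) (complexGaussian 0 Q) P
  noise_law : ∀ k, HasLaw (noise k) (complexGaussian 0 1) P
  indep_supp : ∀ k, IndepFun (supp k) (fun ω => (taps k ω, noise k ω)) P
  indep_taps : ∀ k, IndepFun (taps k) (noise k) P
  indep_blocks : iIndepFun (fun k ω => (supp k ω, taps k ω, noise k ω)) P

end SparseChannel

end

/-! The DFT diagonalizes cyclic convolution, so on the pilot subcarriers the data drop out and `z =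
F_A g + ρ^(-1/2) w`, with `A` the true support, `g` its taps and `w` noise independent of `ρ`. The
residual under `A` thus tends to 0.

Under a wrong `B` it tends to `‖(1 - Π_B) F_A g‖²`. As `N` is prime, Chebotarev's theorem
(`det_pow_ne_zero`) makes any `S + 1` columns independent on the `P ≥ S + 1` pilot rows. A column of
`F_A` outside `B` therefore escapes the range of `F_B`, and the limit is positive unless `g` lies in
a proper subspace, which is null for the Gaussian law.

For almost every taps and noise, `A` eventually beats `B`; dominated convergence turns this into
vanishing probability, and a finite union bound over blocks and pairs of supports finishes. -/

noncomputable section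

namespace SparseChannel

/-! ### Minors of the Fourier matrix of prime order -/

section Chebotarev

open Polynomial

/-- The operator `X · d/dX` multiplies the coefficient of `X ^ b` by `b` and costs at most one
factor `X - 1`; apply it `j` times, then evaluate at 1. -/
theorem sum_mul_pow_eq_zero_of_pow_dvd {F ι : Type*} [CommRing F] [IsDomain F] [Fintype ι]
    (b : ι → ℕ) (j : ℕ) (c : ι → F)
    (h : (X - C 1) ^ (j + 1) ∣ ∑ i, C (c i) * (X : F[X]) ^ b i) :
    ∑ i, c i * (b i : F) ^ j = 0 := by
  induction j generalizing c with
  | zero =>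
    rw [zero_add, pow_one, dvd_iff_isRoot] at h
    simpa [IsRoot, eval_finsetSum] using h
  | succ j ih =>
    have h1 := dvd_mul_of_dvd_right (pow_sub_one_dvd_derivative_of_pow_dvd h) X
    have h2 : X * derivative (∑ i, C (c i) * (X : F[X]) ^ b i) =
        ∑ i, C (c i * b i) * (X : F[X]) ^ b i := by
      rw [derivative_sum, Finset.mul_sum]
      refine Finset.sum_congr rfl fun i _ => ?_
      rw [derivative_C_mul, derivative_X_pow]
      -- The exponent `b i - 1` truncates at `b i = 0`, where the coefficient vanishes anyway.
      rcases Nat.eq_zero_or_pos (b i) with h0 | h0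
      · simp [h0]
      · obtain ⟨m, hm⟩ := Nat.exists_eq_succ_of_ne_zero h0.ne'
        simp only [hm, Nat.succ_eq_add_one, Nat.add_sub_cancel, map_mul, map_natCast]
        ring
    rw [h2] at h1
    have := ih _ h1
    rw [← this]
    exact Finset.sum_congr rfl fun i _ => by ring

/-- In characteristic `p`, a nonzero polynomial of degree less than `p` with at most `m` terms
is not divisible by `(X - 1) ^ m`. -/
theorem eq_zero_of_pow_dvd_sparse {F : Type*} [CommRing F] [IsDomain F] (p : ℕ) [CharP F p]
    {m : ℕ} {b : Fin m → ℕ} (hb : Function.Injective b) (hbp : ∀ i, b i < p) {c : Fin m → F}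
    (h : (X - C 1) ^ m ∣ ∑ i, C (c i) * (X : F[X]) ^ b i) : c = 0 := by
  -- A Vandermonde system whose nodes `b i` stay distinct in `F` because they are below `p`.
  refine Matrix.eq_zero_of_forall_pow_sum_mul_pow_eq_zero (f := fun i => (b i : F)) ?_ fun j =>
    sum_mul_pow_eq_zero_of_pow_dvd b j c ((pow_dvd_pow _ j.2).trans h)
  intro i j hij
  exact hb (CharP.natCast_injOn_Iio F p (hbp i) (hbp j) hij)

/-- The polynomial `∑ c i X ^ b i` has the `m` distinct roots `ζ ^ a j`. Modulo `ζ - 1` they all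
collapse to 1, so its reduction, in characteristic `p`, is divisible by `(X - 1) ^ m`. -/
theorem dvd_coeff_of_sparse_roots {R : Type*} [CommRing R] [IsDomain R] {p : ℕ} (hp : p.Prime)
    {ζ : R} (hζ : IsPrimitiveRoot ζ p) (hπ : Prime (ζ - 1)) (hdvd : ζ - 1 ∣ (p : R))
    {m : ℕ} {a b : Fin m → ℕ} (ha : Function.Injective a) (hap : ∀ i, a i < p)
    (hb : Function.Injective b) (hbp : ∀ i, b i < p) {c : Fin m → R}
    (h : ∀ j, ∑ i, c i * ζ ^ (a j * b i) = 0) (i : Fin m) : ζ - 1 ∣ c i := by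
  set I := Ideal.span {ζ - 1} with hI
  have : I.IsPrime := (Ideal.span_singleton_prime hπ.ne_zero).2 hπ
  have : CharP (R ⧸ I) p := by
    rw [CharP.charP_iff_prime_eq_zero hp, ← map_natCast (Ideal.Quotient.mk I),
      Ideal.Quotient.eq_zero_iff_mem, Ideal.mem_span_singleton]
    exact hdvd
  set G : R[X] := ∑ i, C (c i) * X ^ b i with hG
  have hroot : ∏ j, (X - C (ζ ^ a j)) ∣ G := by
    rcases eq_or_ne G 0 with h0 | h0
    · rw [h0]; exact dvd_zero _
    have hinj : Function.Injective fun j => ζ ^ a j := fun i j hij =>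
      ha (hζ.pow_inj (hap i) (hap j) hij)
    have := (Multiset.prod_X_sub_C_dvd_iff_le_roots h0
      (Finset.univ.val.map fun j => ζ ^ a j)).2 (by
        rw [Multiset.le_iff_subset (Multiset.Nodup.map hinj Finset.univ.nodup)]
        intro x hx
        obtain ⟨j, -, rfl⟩ := Multiset.mem_map.1 hx
        rw [mem_roots h0, IsRoot, hG, eval_finsetSum, ← h j]
        refine Finset.sum_congr rfl fun i _ => ?_
        simp [pow_mul])
    rwa [Multiset.map_map] at this
  have hζ1 : Ideal.Quotient.mk I ζ = 1 := by
    rw [← map_one (Ideal.Quotient.mk I), Ideal.Quotient.eq]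
    exact Ideal.mem_span_singleton_self _
  have hmap := Polynomial.map_dvd (Ideal.Quotient.mk I) hroot
  have h0 := eq_zero_of_pow_dvd_sparse (F := R ⧸ I) p hb hbp
    (c := fun i => Ideal.Quotient.mk I (c i)) (by
      simpa [hG, Polynomial.map_prod, Polynomial.map_sum, hζ1] using hmap)
  exact Ideal.mem_span_singleton.1 (Ideal.Quotient.eq_zero_iff_mem.1 (congrFun h0 i))

/-- Infinite descent: dividing a solution by `ζ - 1` gives another solution, so every power of the
prime `ζ - 1` divides each `c i`. -/
theorem eq_zero_of_sparse_roots {R : Type*} [CommRing R] [IsDomain R] [WfDvdMonoid R] {p : ℕ}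
    (hp : p.Prime) {ζ : R} (hζ : IsPrimitiveRoot ζ p) (hπ : Prime (ζ - 1))
    (hdvd : ζ - 1 ∣ (p : R)) {m : ℕ} {a b : Fin m → ℕ} (ha : Function.Injective a)
    (hap : ∀ i, a i < p) (hb : Function.Injective b) (hbp : ∀ i, b i < p) {c : Fin m → R}
    (h : ∀ j, ∑ i, c i * ζ ^ (a j * b i) = 0) : c = 0 := by
  have key : ∀ n : ℕ, ∀ i, (ζ - 1) ^ n ∣ c i := by
    intro n
    induction n generalizing c with
    | zero => simp
    | succ n ih =>
      choose d hd using dvd_coeff_of_sparse_roots hp hζ hπ hdvd ha hap hb hbp h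
      intro i
      rw [hd i, pow_succ']
      refine mul_dvd_mul_left _ (ih (fun j => ?_) i)
      refine (mul_eq_zero.1 ?_).resolve_left hπ.ne_zero
      rw [← h j, Finset.mul_sum]
      exact Finset.sum_congr rfl fun i _ => by rw [hd i]; ring
  funext i
  by_contra hi
  obtain ⟨n, hn⟩ := FiniteMultiplicity.of_not_isUnit hπ.not_isUnit hi
  exact hn (key _ i)

/-- Chebotarev's theorem on roots of unity: every minor of the Fourier matrix of prime order is
nonzero. -/
theorem det_pow_ne_zero {p : ℕ} (hp : p.Prime) {w : ℂ} (hw : IsPrimitiveRoot w p)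
    {m : ℕ} {a b : Fin m → ℕ} (ha : Function.Injective a) (hap : ∀ i, a i < p)
    (hb : Function.Injective b) (hbp : ∀ i, b i < p) :
    (Matrix.of fun i j => w ^ (a i * b j)).det ≠ 0 := by
  have : Fact p.Prime := ⟨hp⟩
  have : NeZero p := ⟨hp.ne_zero⟩
  -- The minor is the image of one over the ring of integers of `ℚ(w)`, where `w - 1` is a prime
  -- dividing `p`.
  let K := IntermediateField.adjoin ℚ {w}
  have : IsCyclotomicExtension {p} ℚ K := by
    change IsCyclotomicExtension {p} ℚ (IntermediateField.adjoin ℚ {w}).toSubalgebra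
    rw [IntermediateField.adjoin_simple_toSubalgebra_of_isAlgebraic
      ((hw.isIntegral hp.pos).tower_top (A := ℚ)).isAlgebraic]
    exact hw.adjoin_isCyclotomicExtension ℚ
  have : NumberField K := IsCyclotomicExtension.numberField {p} ℚ K
  let z : K := ⟨w, IntermediateField.mem_adjoin_simple_self ℚ w⟩
  have hz : IsPrimitiveRoot z p := IsPrimitiveRoot.coe_submonoidClass_iff.1 hw
  let φ : NumberField.RingOfIntegers K →+* ℂ :=
    (algebraMap K ℂ).comp (algebraMap (NumberField.RingOfIntegers K) K)
  have hφ : Function.Injective φ :=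
    (algebraMap K ℂ).injective.comp NumberField.RingOfIntegers.coe_injective
  have hφz : φ hz.toInteger = w := rfl
  have hdet : (Matrix.of fun i j => w ^ (a i * b j)) =
      φ.mapMatrix (Matrix.of fun i j => hz.toInteger ^ (a i * b j)) := by
    ext i j
    simp [hφz]
  rw [hdet, ← RingHom.map_det, map_ne_zero_iff φ hφ]
  intro h0
  obtain ⟨c, hc0, hc⟩ := Matrix.exists_mulVec_eq_zero_iff.2 h0
  refine hc0 (eq_zero_of_sparse_roots hp hz.toInteger_isPrimitiveRoot hz.zeta_sub_one_prime'
    hz.toInteger_sub_one_dvd_prime' ha hap hb hbp fun j => ?_)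
  simpa [Matrix.mulVec, dotProduct, mul_comm] using congrFun hc j

end Chebotarev

/-! ### The DFT matrix: unitarity and cyclic shifts -/

/-- The root of unity `exp(-2πi / N)`. -/
def dftRoot (N : ℕ) : ℂ := (Complex.exp (2 * Real.pi * Complex.I / N))⁻¹

theorem isPrimitiveRoot_dftRoot {N : ℕ} (hN : N ≠ 0) : IsPrimitiveRoot (dftRoot N) N :=
  (Complex.isPrimitiveRoot_exp N hN).inv

theorem dftMatrix_apply {N : ℕ} (n m : Fin N) :
    dftMatrix N n m = ((Real.sqrt N : ℝ) : ℂ)⁻¹ * dftRoot N ^ ((n : ℕ) * (m : ℕ)) := by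
  rw [dftMatrix, dftRoot, ← Complex.exp_neg, ← Complex.exp_nat_mul]
  congr 2
  push_cast
  ring

theorem star_dftRoot (N : ℕ) : star (dftRoot N) = (dftRoot N)⁻¹ := by
  rw [dftRoot, star_inv₀, Complex.star_def, ← Complex.exp_conj, inv_inv, ← Complex.exp_neg]
  congr 1
  simp only [map_div₀, map_mul, Complex.conj_ofReal, Complex.conj_I, map_natCast, map_ofNat]
  ring

theorem dftMatrix_mul_conjTranspose {N : ℕ} (hN : N ≠ 0) :
    dftMatrix N * (dftMatrix N)ᴴ = 1 := by
  have hw := isPrimitiveRoot_dftRoot hN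
  have hw0 := hw.ne_zero hN
  have hsq : ((Real.sqrt N : ℝ) : ℂ)⁻¹ * ((Real.sqrt N : ℝ) : ℂ)⁻¹ = (N : ℂ)⁻¹ := by
    rw [← mul_inv, ← Complex.ofReal_mul, Real.mul_self_sqrt (Nat.cast_nonneg _),
      Complex.ofReal_natCast]
  ext n m
  -- The inner product of rows `n` and `m` is a geometric sum with ratio `q`, an `N`-th root of
  -- unity.
  set q := dftRoot N ^ (n : ℕ) * (dftRoot N ^ (m : ℕ))⁻¹ with hq
  have hterm : ∀ j : Fin N, dftMatrix N n j * (dftMatrix N)ᴴ j m = (N : ℂ)⁻¹ * q ^ (j : ℕ) := by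
    intro j
    rw [Matrix.conjTranspose_apply, dftMatrix_apply, dftMatrix_apply, star_mul', star_pow,
      star_dftRoot, star_inv₀, Complex.star_def, Complex.conj_ofReal, ← hsq, hq, mul_pow,
      ← pow_mul, inv_pow, inv_pow, ← pow_mul]
    ring
  rw [Matrix.mul_apply, Finset.sum_congr rfl fun j _ => hterm j, ← Finset.mul_sum,
    Fin.sum_univ_eq_sum_range (fun j => q ^ j) N]
  have hN' : (N : ℂ) ≠ 0 := Nat.cast_ne_zero.2 hN
  by_cases hnm : n = m
  · have hq1 : q = 1 := by rw [hq, hnm, mul_inv_cancel₀ (pow_ne_zero _ hw0)]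
    rw [hnm, Matrix.one_apply_eq]
    simp [hq1, hN']
  · have hq1 : q ≠ 1 := by
      intro h
      rw [hq, mul_inv_eq_one₀ (pow_ne_zero _ hw0)] at h
      exact hnm (Fin.ext (hw.pow_inj n.2 m.2 h))
    have hqN : q ^ N = 1 := by
      rw [hq, mul_pow, inv_pow, pow_right_comm, hw.pow_eq_one,
        pow_right_comm, hw.pow_eq_one]
      simp
    rw [geom_sum_eq hq1, hqN, Matrix.one_apply_ne hnm]
    simp

/-- The DFT turns a cyclic shift into a modulation. -/
theorem dftMatrix_shift {N : ℕ} (hN : N ≠ 0) (x : Fin N → ℂ) (k : Fin N) {l : ℕ} (hl : l < N) :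
    ∑ n : Fin N, dftMatrix N k n * x ⟨((n : ℕ) + N - l) % N, Nat.mod_lt _ n.pos⟩ =
      dftRoot N ^ ((k : ℕ) * l) * (dftMatrix N *ᵥ x) k := by
  have : NeZero N := ⟨hN⟩
  have hw := isPrimitiveRoot_dftRoot hN
  rw [Matrix.mulVec, dotProduct, Finset.mul_sum]
  refine Fintype.sum_equiv (Equiv.subRight (⟨l, hl⟩ : Fin N)) _ _ fun n => ?_
  have hidx : (⟨((n : ℕ) + N - l) % N, Nat.mod_lt _ n.pos⟩ : Fin N) = n - ⟨l, hl⟩ := by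
    apply Fin.ext
    rw [Fin.val_sub]
    change ((n : ℕ) + N - l) % N = (N - l + n) % N
    congr 1
    omega
  rw [hidx, Equiv.subRight_apply]
  set m : Fin N := n - ⟨l, hl⟩ with hm
  have hn : n = m + ⟨l, hl⟩ := by rw [hm, sub_add_cancel]
  have hpow : (dftRoot N ^ (k : ℕ)) ^ (n : ℕ) = (dftRoot N ^ (k : ℕ)) ^ ((m : ℕ) + l) := by
    rw [hn, Fin.val_add]
    refine (pow_eq_pow_mod _ ?_).symm
    rw [← pow_mul, mul_comm, pow_mul, hw.pow_eq_one, one_pow]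
  rw [dftMatrix_apply, dftMatrix_apply, pow_mul, hpow, pow_mul, pow_mul, pow_add]
  ring

/-! ### Identifiability of the support from the pilots -/

/-- A vector of taps supported on at most `|Np|` positions is determined by the frequency
response on `Np`. -/
theorem eq_zero_of_dft_eq_zero {N L : ℕ} (hN : N.Prime) (hLN : L ≤ N) (Np : Finset (Fin N))
    (C : Finset (Fin L)) (hC : C.card ≤ Np.card) (d : Fin L → ℂ)
    (h : ∀ n ∈ Np, ∑ l ∈ C, dftMatrix N n (Fin.castLE hLN l) * d l = 0) : ∀ l ∈ C, d l = 0 := by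
  -- Discarding surplus pilot rows leaves a square minor.
  obtain ⟨R, hR, hRC⟩ := Finset.exists_subset_card_eq hC
  let a : Fin C.card → ℕ := fun i => (R.orderEmbOfFin hRC i : Fin N)
  let b : Fin C.card → ℕ := fun i => (C.orderEmbOfFin rfl i : Fin L)
  have hdet := det_pow_ne_zero hN (isPrimitiveRoot_dftRoot hN.ne_zero) (a := a) (b := b)
    (Fin.val_injective.comp (R.orderEmbOfFin hRC).injective) (fun i => Fin.is_lt _)
    (Fin.val_injective.comp (C.orderEmbOfFin rfl).injective)
    (fun i => (Fin.is_lt _).trans_le hLN)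
  have hs : ((Real.sqrt N : ℝ) : ℂ)⁻¹ ≠ 0 := by
    have := hN.pos
    simp only [ne_eq, inv_eq_zero, Complex.ofReal_eq_zero]
    positivity
  have hz := Matrix.eq_zero_of_mulVec_eq_zero hdet (v := fun i => d (C.orderEmbOfFin rfl i)) (by
    funext j
    refine (mul_eq_zero.1 ?_).resolve_left hs
    rw [← h _ (hR (R.orderEmbOfFin_mem hRC j)), Matrix.mulVec, dotProduct, Finset.mul_sum,
      ← Finset.sum_coe_sort C]
    refine Fintype.sum_equiv (C.orderIsoOfFin rfl).toEquiv _ _ fun i => ?_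
    rw [dftMatrix_apply, mul_assoc]
    rfl)
  intro l hl
  have := congrFun hz ((C.orderIsoOfFin rfl).symm ⟨l, hl⟩)
  simpa [← Finset.coe_orderIsoOfFin_apply] using this

theorem pilotDFT_mulVec_eq_zero {N L S : ℕ} (hN : N.Prime) (hLN : L ≤ N) (Np : Finset (Fin N))
    (hNp : S ≤ Np.card) (A : Support L S) (u : {l // l ∈ A.1} → ℂ)
    (h : pilotDFT hLN Np A *ᵥ u = 0) : u = 0 := by
  have := eq_zero_of_dft_eq_zero hN hLN Np A.1 (A.2.le.trans hNp)
    (fun l => if hl : l ∈ A.1 then u ⟨l, hl⟩ else 0) (fun n hn => by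
      rw [← Finset.sum_coe_sort A.1]
      simpa [Matrix.mulVec, dotProduct, pilotDFT] using congrFun h ⟨n, hn⟩)
  funext l
  simpa using this l.1 l.2

/-- Independent columns make the Gram matrix invertible, so the formula for `Π` uses a genuine
inverse. -/
theorem one_sub_pilotProjection_mul_pilotDFT {N L S : ℕ} (hN : N.Prime) (hLN : L ≤ N)
    (Np : Finset (Fin N)) (hNp : S ≤ Np.card) (A : Support L S) :
    (1 - pilotProjection hLN Np A) * pilotDFT hLN Np A = 0 := by
  have hdet : ((pilotDFT hLN Np A)ᴴ * pilotDFT hLN Np A).det ≠ 0 := by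
    intro h0
    obtain ⟨v, hv0, hv⟩ := Matrix.exists_mulVec_eq_zero_iff.2 h0
    exact hv0 (pilotDFT_mulVec_eq_zero hN hLN Np hNp A v
      ((Matrix.conjTranspose_mul_self_mulVec_eq_zero _ _).1 hv))
  rw [Matrix.sub_mul, Matrix.one_mul, pilotProjection, Matrix.mul_assoc, Matrix.mul_assoc,
    Matrix.nonsing_inv_mul _ (isUnit_iff_ne_zero.2 hdet), Matrix.mul_one, sub_self]

theorem one_sub_pilotProjection_mul_pilotDFT_ne_zero {N L S : ℕ} (hN : N.Prime) (hLN : L ≤ N)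
    (Np : Finset (Fin N)) (hNp : S + 1 ≤ Np.card) {A B : Support L S} (hAB : A ≠ B) :
    (1 - pilotProjection hLN Np B) * pilotDFT hLN Np A ≠ 0 := by
  intro h0
  obtain ⟨l₀, hl₀A, hl₀B⟩ : ∃ l ∈ A.1, l ∉ B.1 := by
    by_contra! hsub
    exact hAB (Subtype.ext (Finset.eq_of_subset_of_card_le hsub (A.2.trans B.2.symm).ge))
  set u : {l // l ∈ B.1} → ℂ := ((pilotDFT hLN Np B)ᴴ * pilotDFT hLN Np B)⁻¹ *ᵥ
    ((pilotDFT hLN Np B)ᴴ *ᵥ (pilotDFT hLN Np A).col ⟨l₀, hl₀A⟩) with hu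
  have hcol : (pilotDFT hLN Np A).col ⟨l₀, hl₀A⟩ = pilotDFT hLN Np B *ᵥ u := by
    rw [Matrix.sub_mul, Matrix.one_mul, sub_eq_zero] at h0
    rw [hu, Matrix.mulVec_mulVec, Matrix.mulVec_mulVec]
    change _ = pilotProjection hLN Np B *ᵥ _
    conv_lhs => rw [h0]
    rfl
  -- Column `l₀` as a combination of the columns in `B` is a relation among `S + 1` columns, with
  -- coefficient `-1` at `l₀`.
  have := eq_zero_of_dft_eq_zero hN hLN Np (insert l₀ B.1)
    (by rw [Finset.card_insert_of_notMem hl₀B, B.2]; exact hNp)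
    (fun l => if hl : l ∈ B.1 then u ⟨l, hl⟩ else -1) (fun n hn => by
      rw [Finset.sum_insert hl₀B, ← Finset.sum_coe_sort B.1]
      have := congrFun hcol ⟨n, hn⟩
      simp only [Matrix.mulVec, dotProduct, pilotDFT, Matrix.col_apply] at this
      simp [hl₀B, this]) l₀ (Finset.mem_insert_self _ _)
  simp [hl₀B] at this

/-! ### Signal and noise in the pilot observations -/

/-- The noise-free normalized observation for the support `A` and the nonzero taps `g`. -/
def pilotSignal {N L S : ℕ} (hLN : L ≤ N) (Np : Finset (Fin N)) (A : Support L S)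
    (g : Fin S → ℂ) : {n // n ∈ Np} → ℂ :=
  pilotDFT hLN Np A *ᵥ fun l => g ((A.1.orderIsoOfFin A.2).symm l)

/-- The noise in the normalized observation at unit signal-to-noise ratio. -/
def pilotNoise {N : ℕ} (Np : Finset (Fin N)) (pilot : {n // n ∈ Np} → ℂ) (v : Fin N → ℂ)
    (n : {n // n ∈ Np}) : ℂ :=
  ((Real.sqrt N : ℝ) : ℂ)⁻¹ * (star (pilot n) * (dftMatrix N *ᵥ v) n)

theorem dftMatrix_mulVec_received {N L : ℕ} (hN : N ≠ 0) (hLN : L ≤ N) (ρ : ℝ)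
    (h : Fin L → ℂ) (xf v : Fin N → ℂ) (k : Fin N) :
    (dftMatrix N *ᵥ received ρ h ((dftMatrix N)ᴴ *ᵥ xf) v) k =
      (Real.sqrt ρ : ℝ) * (∑ l : Fin L, dftRoot N ^ ((k : ℕ) * (l : ℕ)) * h l) * xf k +
        (dftMatrix N *ᵥ v) k := by
  have hF : (dftMatrix N *ᵥ ((dftMatrix N)ᴴ *ᵥ xf)) k = xf k := by
    rw [Matrix.mulVec_mulVec, dftMatrix_mul_conjTranspose hN, Matrix.one_mulVec]
  set x := (dftMatrix N)ᴴ *ᵥ xf with hx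
  have hsplit : (dftMatrix N *ᵥ received ρ h x v) k =
      (Real.sqrt ρ : ℝ) * (∑ l : Fin L, h l * ∑ n : Fin N, dftMatrix N k n *
        x ⟨((n : ℕ) + N - (l : ℕ)) % N, Nat.mod_lt _ n.pos⟩) + (dftMatrix N *ᵥ v) k := by
    simp only [Matrix.mulVec, dotProduct, received, mul_add, Finset.sum_add_distrib,
      Finset.mul_sum]
    rw [Finset.sum_comm]
    congr 1
    refine Finset.sum_congr rfl fun l _ => Finset.sum_congr rfl fun n _ => ?_
    ring
  rw [hsplit, mul_assoc, Finset.sum_mul]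
  congr 2
  refine Finset.sum_congr rfl fun l _ => ?_
  rw [dftMatrix_shift hN x k (l.2.trans_le hLN), hF]
  ring

theorem normalizedObservation_pilotObservation {N L S : ℕ} (hN : N ≠ 0) (hLN : L ≤ N)
    {ρ : ℝ} (hρ : 0 < ρ) (Np : Finset (Fin N)) (pilot : {n // n ∈ Np} → ℂ)
    (hpilot : ∀ n, ‖pilot n‖ = 1) (data : {n // n ∉ Np} → ℂ) (A : Support L S)
    (g : Fin S → ℂ) (v : Fin N → ℂ) :
    normalizedObservation ρ Np pilot
        (pilotObservation ρ Np pilot data (impulseResponse A g) v) =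
      pilotSignal hLN Np A g + ((Real.sqrt ρ : ℝ) : ℂ)⁻¹ • pilotNoise Np pilot v := by
  funext n
  have hpp : star (pilot n) * pilot n = 1 := by
    rw [Complex.star_def, Complex.conj_mul', hpilot]
    simp
  have hρ' : ((Real.sqrt ρ : ℝ) : ℂ) ≠ 0 := by
    rw [Complex.ofReal_ne_zero]; positivity
  have hsum : ((Real.sqrt N : ℝ) : ℂ)⁻¹ *
      ∑ l : Fin L, dftRoot N ^ ((n.1 : ℕ) * (l : ℕ)) * impulseResponse A g l =
        pilotSignal hLN Np A g n := by
    rw [pilotSignal, Matrix.mulVec, dotProduct, Finset.mul_sum, ← Finset.sum_subset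
      (Finset.subset_univ A.1) (fun l _ hl => by simp [impulseResponse, hl]),
      ← Finset.sum_coe_sort A.1]
    refine Finset.sum_congr rfl fun l _ => ?_
    simp [impulseResponse, pilotDFT, dftMatrix_apply, mul_assoc]
  rw [normalizedObservation, pilotObservation, dftMatrix_mulVec_received hN hLN, patVector,
    dif_pos n.2, Pi.add_apply, Pi.smul_apply, smul_eq_mul, ← hsum, pilotNoise,
    Real.sqrt_mul hρ.le, Complex.ofReal_mul, mul_inv]
  set s := ∑ l : Fin L, dftRoot N ^ ((n.1 : ℕ) * (l : ℕ)) * impulseResponse A g l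
  calc _ = ((Real.sqrt ρ : ℝ) : ℂ)⁻¹ * ((Real.sqrt ρ : ℝ) : ℂ) * (((Real.sqrt N : ℝ) : ℂ)⁻¹ * s) *
        (star (pilot n) * pilot n) + ((Real.sqrt ρ : ℝ) : ℂ)⁻¹ *
        (((Real.sqrt N : ℝ) : ℂ)⁻¹ * (star (pilot n) * (dftMatrix N *ᵥ v) n)) := by ring
    _ = _ := by rw [hpp, inv_mul_cancel₀ hρ']; ring

/-! ### The high-SNR limit for a fixed pair of supports -/

theorem continuous_residualEnergy {N L S : ℕ} (hLN : L ≤ N) (Np : Finset (Fin N))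
    (A : Support L S) : Continuous fun z => residualEnergy hLN Np z A := by
  unfold residualEnergy Matrix.mulVec dotProduct
  fun_prop

theorem continuous_pilotSignal {N L S : ℕ} (hLN : L ≤ N) (Np : Finset (Fin N))
    (A : Support L S) : Continuous (pilotSignal hLN Np A) := by
  unfold pilotSignal Matrix.mulVec dotProduct
  fun_prop

theorem continuous_pilotNoise {N : ℕ} (Np : Finset (Fin N)) (pilot : {n // n ∈ Np} → ℂ) :
    Continuous (pilotNoise Np pilot) := by
  unfold pilotNoise Matrix.mulVec dotProduct
  fun_prop

theorem eventually_residualEnergy_lt {N L S : ℕ} (hLN : L ≤ N) (Np : Finset (Fin N))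
    {A B : Support L S} (s w : {n // n ∈ Np} → ℂ)
    (hA : (1 - pilotProjection hLN Np A) *ᵥ s = 0)
    (hB : (1 - pilotProjection hLN Np B) *ᵥ s ≠ 0) :
    ∀ᶠ ρ : ℝ in atTop,
      residualEnergy hLN Np (s + ((Real.sqrt ρ : ℝ) : ℂ)⁻¹ • w) A <
        residualEnergy hLN Np (s + ((Real.sqrt ρ : ℝ) : ℂ)⁻¹ • w) B := by
  have ht : Tendsto (fun ρ : ℝ => ((Real.sqrt ρ : ℝ) : ℂ)⁻¹) atTop (𝓝 0) := by
    have := (Complex.continuous_ofReal.tendsto 0).comp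
      (tendsto_inv_atTop_zero.comp Real.tendsto_sqrt_atTop)
    simpa [Function.comp_def] using this
  have hs : Tendsto (fun ρ : ℝ => s + ((Real.sqrt ρ : ℝ) : ℂ)⁻¹ • w) atTop (𝓝 s) := by
    simpa using tendsto_const_nhds.add (ht.smul_const w)
  refine (((continuous_residualEnergy hLN Np A).tendsto s).comp hs).eventually_lt
    (((continuous_residualEnergy hLN Np B).tendsto s).comp hs) ?_
  have h0 : residualEnergy hLN Np s A = 0 := by simp [residualEnergy, hA]
  obtain ⟨n, hn⟩ := Function.ne_iff.1 hB
  rw [h0]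
  exact Finset.sum_pos' (fun _ _ => by positivity)
    ⟨n, Finset.mem_univ n, pow_pos (norm_pos_iff.2 hn) 2⟩

theorem one_sub_pilotProjection_mulVec_pilotSignal {N L S : ℕ} (hN : N.Prime) (hLN : L ≤ N)
    (Np : Finset (Fin N)) (hNp : S ≤ Np.card) (A : Support L S) (g : Fin S → ℂ) :
    (1 - pilotProjection hLN Np A) *ᵥ pilotSignal hLN Np A g = 0 := by
  rw [pilotSignal, Matrix.mulVec_mulVec, one_sub_pilotProjection_mul_pilotDFT hN hLN Np hNp,
    Matrix.zero_mulVec]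

/-- For almost all taps, the noise-free observation is not consistent with a wrong support. -/
theorem ae_one_sub_pilotProjection_mulVec_pilotSignal_ne_zero {N L S : ℕ} (hN : N.Prime)
    (hLN : L ≤ N) (Np : Finset (Fin N)) (hNp : S + 1 ≤ Np.card) {A B : Support L S}
    (hAB : A ≠ B) :
    ∀ᵐ g : Fin S → ℂ, (1 - pilotProjection hLN Np B) *ᵥ pilotSignal hLN Np A g ≠ 0 := by
  let M := (1 - pilotProjection hLN Np B) * pilotDFT hLN Np A
  -- Real scalars, because proper subspaces are Haar-null as subspaces of a real vector space.
  let T : (Fin S → ℂ) →ₗ[ℝ] ({n // n ∈ Np} → ℂ) :=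
    ((Matrix.mulVecLin M).comp
      (LinearMap.funLeft ℂ ℂ (A.1.orderIsoOfFin A.2).symm)).restrictScalars ℝ
  have hT : ∀ g, T g = (1 - pilotProjection hLN Np B) *ᵥ pilotSignal hLN Np A g := fun g => by
    rw [pilotSignal, Matrix.mulVec_mulVec]
    rfl
  have hker : LinearMap.ker T ≠ ⊤ := by
    rw [Ne, LinearMap.ker_eq_top]
    intro h0
    refine one_sub_pilotProjection_mul_pilotDFT_ne_zero hN hLN Np hNp hAB
      (Matrix.mulVec_injective (funext fun u => ?_))
    have := LinearMap.congr_fun h0 (u ∘ A.1.orderIsoOfFin A.2)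
    rw [hT, pilotSignal, Matrix.mulVec_mulVec] at this
    simpa using this
  have := Measure.addHaar_submodule (volume : Measure (Fin S → ℂ)) _ hker
  rw [ae_iff]
  convert this using 2
  ext g
  simp [hT]

/-- The probability that a fixed wrong support `B` fits the observation at least as well as the
support `A` that has been used vanishes at high signal-to-noise ratio. -/
theorem tendsto_measure_residualEnergy_le {Ω : Type*} [MeasurableSpace Ω] (P : Measure Ω)
    [IsFiniteMeasure P] {N L S : ℕ} (hN : N.Prime) (hLN : L ≤ N) (Np : Finset (Fin N))
    (hNp : S + 1 ≤ Np.card) (pilot : {n // n ∈ Np} → ℂ) {A B : Support L S} (hAB : A ≠ B)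
    {taps : Ω → Fin S → ℂ} {noise : Ω → Fin N → ℂ} (htaps : AEMeasurable taps P)
    (hnoise : AEMeasurable noise P) (hac : P.map taps ≪ volume) :
    Tendsto (fun ρ : ℝ => P {ω |
      residualEnergy hLN Np (pilotSignal hLN Np A (taps ω) +
          ((Real.sqrt ρ : ℝ) : ℂ)⁻¹ • pilotNoise Np pilot (noise ω)) B ≤
        residualEnergy hLN Np (pilotSignal hLN Np A (taps ω) +
          ((Real.sqrt ρ : ℝ) : ℂ)⁻¹ • pilotNoise Np pilot (noise ω)) A}) atTop (𝓝 0) := by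
  let E : ℝ → Set ((Fin S → ℂ) × (Fin N → ℂ)) := fun ρ => {x |
    residualEnergy hLN Np (pilotSignal hLN Np A x.1 +
        ((Real.sqrt ρ : ℝ) : ℂ)⁻¹ • pilotNoise Np pilot x.2) B ≤
      residualEnergy hLN Np (pilotSignal hLN Np A x.1 +
        ((Real.sqrt ρ : ℝ) : ℂ)⁻¹ • pilotNoise Np pilot x.2) A}
  have hpair : AEMeasurable (fun ω => (taps ω, noise ω)) P := htaps.prodMk hnoise
  have hE : ∀ ρ, MeasurableSet (E ρ) := fun ρ => by
    have hs : Continuous fun x : (Fin S → ℂ) × (Fin N → ℂ) => pilotSignal hLN Np A x.1 :=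
      (continuous_pilotSignal hLN Np A).comp continuous_fst
    have hw : Continuous fun x : (Fin S → ℂ) × (Fin N → ℂ) => pilotNoise Np pilot x.2 :=
      (continuous_pilotNoise Np pilot).comp continuous_snd
    have hc := hs.add (hw.const_smul ((Real.sqrt ρ : ℝ) : ℂ)⁻¹)
    exact (isClosed_le ((continuous_residualEnergy hLN Np B).comp hc)
      ((continuous_residualEnergy hLN Np A).comp hc)).measurableSet
  have hae : ∀ᵐ x ∂P.map (fun ω => (taps ω, noise ω)),
      (1 - pilotProjection hLN Np B) *ᵥ pilotSignal hLN Np A x.1 ≠ 0 := by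
    have hcont : Continuous fun g : Fin S → ℂ =>
        (1 - pilotProjection hLN Np B) *ᵥ pilotSignal hLN Np A g :=
      continuous_const.matrix_mulVec (continuous_pilotSignal hLN Np A)
    have hopen : IsOpen {g : Fin S → ℂ |
        (1 - pilotProjection hLN Np B) *ᵥ pilotSignal hLN Np A g ≠ 0} :=
      isOpen_ne_fun hcont continuous_const
    refine (ae_map_iff hpair (hopen.preimage continuous_fst).measurableSet).2 ?_
    exact (ae_map_iff htaps hopen.measurableSet).1
      (hac.ae_le (ae_one_sub_pilotProjection_mulVec_pilotSignal_ne_zero hN hLN Np hNp hAB))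
  -- The indicators of `E ρ` tend almost everywhere to that of the empty set.
  have hlim := tendsto_measure_of_ae_tendsto_indicator_of_isFiniteMeasure atTop
    MeasurableSet.empty hE (hae.mono fun x hx => (eventually_residualEnergy_lt hLN Np _
      (pilotNoise Np pilot x.2) (one_sub_pilotProjection_mulVec_pilotSignal hN hLN Np
        (Nat.le_of_succ_le hNp) A x.1) hx).mono fun ρ hρ =>
      iff_of_false (not_le.2 hρ) (Set.notMem_empty x))
  rw [measure_empty] at hlim
  refine hlim.congr fun ρ => ?_
  rw [Measure.map_apply_of_aemeasurable hpair (hE ρ)]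
  rfl

end SparseChannel

end

/-- The pilot-aided support estimator is asymptotically reliable. The data symbols are arbitrary
(they may be random and may depend on `ρ`), and so is the way in which the estimator breaks
ties. -/
theorem theorem3 {Ω : Type*} [MeasurableSpace Ω] (P : Measure Ω) [IsProbabilityMeasure P]
    (N L S K : ℕ) (hN : N.Prime) (hS : 1 ≤ S) (hSL : S ≤ L) (hLN : L < N)
    (prior : PMF (SparseChannel.Support L S))
    (Q : Matrix (Fin S) (Fin S) ℂ) (hQ : Q.PosDef)
    (supp : Fin K → Ω → SparseChannel.Support L S)
    (taps : Fin K → Ω → Fin S → ℂ)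
    (noise : Fin K → Ω → Fin N → ℂ)
    (hmodel : SparseChannel.IsSparseFading P prior Q supp taps noise)
    (Np : Finset (Fin N)) (hNp : S + 1 ≤ Np.card)
    (pilot : {n // n ∈ Np} → ℂ) (hpilot : ∀ n, ‖pilot n‖ = 1)
    (data : ℝ → Fin K → Ω → {n // n ∉ Np} → ℂ)
    (est : ℝ → Fin K → Ω → SparseChannel.Support L S)
    (hest : ∀ ρ : ℝ, 0 < ρ → ∀ k ω,
      SparseChannel.IsPASE hLN.le ρ Np pilot
        (SparseChannel.pilotObservation ρ Np pilot (data ρ k ω)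
          (SparseChannel.impulseResponse (supp k ω) (taps k ω)) (noise k ω))
        (est ρ k ω)) :
    Tendsto (fun ρ : ℝ => P {ω | ∃ k, est ρ k ω ≠ supp k ω}) atTop (𝓝 0) := by
  classical
  -- Fixing both supports in `D` avoids conditioning on the random support: any error lies in the
  -- event for the realized pair (true, estimated).
  let D : ℝ → Fin K → SparseChannel.Support L S × SparseChannel.Support L S → Set Ω :=
    fun ρ k AB => {ω |
      SparseChannel.residualEnergy hLN.le Np
          (SparseChannel.pilotSignal hLN.le Np AB.1 (taps k ω) +
            ((Real.sqrt ρ : ℝ) : ℂ)⁻¹ • SparseChannel.pilotNoise Np pilot (noise k ω)) AB.2 ≤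
        SparseChannel.residualEnergy hLN.le Np
          (SparseChannel.pilotSignal hLN.le Np AB.1 (taps k ω) +
            ((Real.sqrt ρ : ℝ) : ℂ)⁻¹ • SparseChannel.pilotNoise Np pilot (noise k ω)) AB.1}
  let J := Finset.univ.filter fun AB :
    SparseChannel.Support L S × SparseChannel.Support L S => AB.1 ≠ AB.2
  have hlim : Tendsto (fun ρ : ℝ => ∑ k : Fin K, ∑ AB ∈ J, P (D ρ k AB)) atTop (𝓝 0) := by
    rw [show (0 : ENNReal) = ∑ k : Fin K, ∑ AB ∈ J, 0 by simp]
    refine tendsto_finsetSum _ fun k _ => tendsto_finsetSum _ fun AB hAB => ?_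
    refine SparseChannel.tendsto_measure_residualEnergy_le P hN hLN.le Np hNp pilot
      (Finset.mem_filter.1 hAB).2 (hmodel.taps_law k).aemeasurable
      (hmodel.noise_law k).aemeasurable ?_
    rw [(hmodel.taps_law k).map_eq]
    exact withDensity_absolutelyContinuous _ _
  refine tendsto_of_tendsto_of_tendsto_of_le_of_le' tendsto_const_nhds hlim
    (Eventually.of_forall fun _ => zero_le) ?_
  filter_upwards [eventually_gt_atTop 0] with ρ hρ
  have hsub : {ω | ∃ k, est ρ k ω ≠ supp k ω} ⊆ ⋃ k ∈ Finset.univ, ⋃ AB ∈ J, D ρ k AB := by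
    rintro ω ⟨k, hk⟩
    have h := hest ρ hρ k ω (supp k ω)
    rw [SparseChannel.normalizedObservation_pilotObservation hN.ne_zero hLN.le hρ Np pilot
      hpilot] at h
    simp only [Set.mem_iUnion]
    exact ⟨k, Finset.mem_univ k, (supp k ω, est ρ k ω),
      Finset.mem_filter.2 ⟨Finset.mem_univ _, hk.symm⟩, h⟩
  calc P {ω | ∃ k, est ρ k ω ≠ supp k ω} ≤ P (⋃ k ∈ Finset.univ, ⋃ AB ∈ J, D ρ k AB) :=
        measure_mono hsub
    _ ≤ ∑ k : Fin K, P (⋃ AB ∈ J, D ρ k AB) := measure_biUnion_finset_le _ _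
    _ ≤ _ := Finset.sum_le_sum fun k _ => measure_biUnion_finset_le _ _
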